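/- An instance of the broadcaster-repacking problem (BRP) consists of a finite set $S\subset\mathbb N$ of stations, a finite set $C_s\subset\mathbb N$ of channels (the domain) for every $s\in S$, and a set $I\subseteq (S\times C)^2$ of interference constraints, where $C=\bigcup_{s\in S}C_s$ and no element of $I$ has the form $((s,c_1),(s,c_2))$. Its input data are $(I,D)$ with $D=\{C_s\}_{s\in S}$. A complete feasible assignment is a map $f:S\to C$ with $f(s)\in C_s$ for all $s\in S$ such that, for all $((s_1,c_1),(s_2,c_2))\in I$, $f(s_1)=c_1$ implies $f(s_2)\neq c_2$; its cost is $\|f\|=\max_{s\in S}f(s)$ (with $\|f\|=0$ if $S=\emptyset$). The optimization variant of the BRP is to return a complete feasible assignment of minimum cost, or to report that there is no complete feasible assignment. For $c^*\in C$, the clearing-target subproblem at $c^*$ is obtained by replacing every $C_s$ by $\{c\in C_s : c\le c^*\}$ and keeping $S$ and $I$. The constraint graph of an instance has the vertices $(s,c)$ with $s\in S$, $c\in C_s$; two distinct vertices are adjacent if they have the same station or if they form, in one of the two orders, an interference constraint. An oracle for the maximum independent set problem (MISP) answers every finite simple graph, coded by the list of its vertices and a list of its edges, with a list of the vertices of some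 maximum independent set of that graph. Theorem. The optimization variant of the BRP has a polynomial-time (oracle) reduction to the MISP that makes $O(\log|C|)$ oracle calls, each of them the feasibility test of a clearing-target subproblem. Precisely, there are a program $P$ with oracle calls, a polynomial $p$ and a constant $K$ such that for every oracle for the MISP, every BRP instance $(I,D)$ and every list coding $x$ of $(I,D)$ (numbers in binary), $P$ with input $x$ halts and 1. returns a complete feasible assignment of minimum cost if there is a complete feasible assignment, and otherwise reports that there is none; 2. runs in time at most $p(|x|)$, where $|x|$ is the size of $x$ in bits (up to a constant factor), time is counted with bit cost, and every oracle call is charged for writing the question and reading the answer; 3. makes at most $K(\lfloor\log_2|C|\rfloor+1)$ oracle calls (with $\lfloor\log_2 0\rfloor$ read as $0$); 4. in every oracle call asks for a maximum independent set of the constraint graph of the subproblem with some clearing target $c^*\in C$, and this subproblem has a complete feasible assignment if and only if the independence number of that graph is $|S|$. Programs are while-programs with finitely many variables, whose values are finite binary trees with natural numbers at the leaves; expressions are built from variables and constants by pairing, projections, addition, truncated subtraction, comparison and equality, and each operation costs the size in bits of its operands and its result. -/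

import Mathlib

namespace BRP

/-! ### A machine model with oracle calls and bit cost

Programs are while-programs over finite binary trees whose leaves are natural numbers. Arithmetic
and tree operations are charged by the number of bits of the values they produce (logarithmic cost),
and an oracle call is charged for writing the question and for reading the answer. -/

/-- Values: binary trees with natural numbers at the leaves. -/
inductive Data : Type
  | nat (n : ℕ) : Data
  | cons (a b : Data) : Data
  deriving DecidableEq

namespace Data

/-- Number of symbols needed to write down a value, numbers being written in binary. -/
def size : Data → ℕ
  | nat n => Nat.size n + 1
  | cons a b => a.size + b.size + 1

/-- The number at a leaf (`0` for a tree that is not a leaf). -/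
def toNat : Data → ℕ
  | nat n => n
  | cons _ _ => 0

/-- First component (`0` for a leaf). -/
def hd : Data → Data
  | nat _ => nat 0
  | cons a _ => a

/-- Second component (`0` for a leaf). -/
def tl : Data → Data
  | nat _ => nat 0
  | cons _ b => b

/-- Lists of values as values: right-nested pairs, ended by `0`. -/
def ofList : List Data → Data
  | [] => nat 0
  | a :: l => cons a (ofList l)

end Data

/-- Expressions; program variables are numbered. -/
inductive Expr : Type
  | var (i : ℕ) : Expr
  | const (n : ℕ) : Expr
  | cons (e₁ e₂ : Expr) : Expr
  | hd (e : Expr) : Expr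
  | tl (e : Expr) : Expr
  | add (e₁ e₂ : Expr) : Expr
  | sub (e₁ e₂ : Expr) : Expr
  | lt (e₁ e₂ : Expr) : Expr
  | eq (e₁ e₂ : Expr) : Expr

/-- The contents of the program variables. -/
abbrev Store : Type := ℕ → Data

namespace Expr

/-- Value of an expression; tests return the numbers `1` and `0`, subtraction is truncated. -/
def eval (σ : Store) : Expr → Data
  | var i => σ i
  | const n => .nat n
  | cons e₁ e₂ => .cons (e₁.eval σ) (e₂.eval σ)
  | hd e => (e.eval σ).hd
  | tl e => (e.eval σ).tl
  | add e₁ e₂ => .nat ((e₁.eval σ).toNat + (e₂.eval σ).toNat)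
  | sub e₁ e₂ => .nat ((e₁.eval σ).toNat - (e₂.eval σ).toNat)
  | lt e₁ e₂ => .nat (if (e₁.eval σ).toNat < (e₂.eval σ).toNat then 1 else 0)
  | eq e₁ e₂ => .nat (if e₁.eval σ = e₂.eval σ then 1 else 0)

/-- Bit cost of evaluating an expression: the sum of the sizes of the values of all its
subexpressions, itself included. -/
def cost (σ : Store) : Expr → ℕ
  | var i => (σ i).size
  | const n => (Data.nat n).size
  | cons e₁ e₂ => e₁.cost σ + e₂.cost σ + ((cons e₁ e₂).eval σ).size
  | hd e => e.cost σ + ((hd e).eval σ).size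
  | tl e => e.cost σ + ((tl e).eval σ).size
  | add e₁ e₂ => e₁.cost σ + e₂.cost σ + ((add e₁ e₂).eval σ).size
  | sub e₁ e₂ => e₁.cost σ + e₂.cost σ + ((sub e₁ e₂).eval σ).size
  | lt e₁ e₂ => e₁.cost σ + e₂.cost σ + ((lt e₁ e₂).eval σ).size
  | eq e₁ e₂ => e₁.cost σ + e₂.cost σ + ((eq e₁ e₂).eval σ).size

end Expr

/-- Programs. `ite` and `loop` (a while loop) test whether an expression differs from the number
`0`; `query i e` stores in variable `i` the answer of the oracle to the value of `e`. -/
inductive Prog : Type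
  | skip : Prog
  | assign (i : ℕ) (e : Expr) : Prog
  | query (i : ℕ) (e : Expr) : Prog
  | seq (P Q : Prog) : Prog
  | ite (e : Expr) (P Q : Prog) : Prog
  | loop (e : Expr) (P : Prog) : Prog

/-- `Exec O P σ σ' t qs`: with oracle `O` and started in the store `σ`, the program `P` halts in the
store `σ'` after time `t`, having put to the oracle the questions `qs`, in this order. -/
inductive Exec (O : Data → Data) : Prog → Store → Store → ℕ → List Data → Prop
  | skip (σ : Store) : Exec O .skip σ σ 1 []
  | assign (i : ℕ) (e : Expr) (σ : Store) :
      Exec O (.assign i e) σ (Function.update σ i (e.eval σ)) (e.cost σ + 1) []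
  | query (i : ℕ) (e : Expr) (σ : Store) :
      Exec O (.query i e) σ (Function.update σ i (O (e.eval σ)))
        (e.cost σ + (O (e.eval σ)).size + 1) [e.eval σ]
  | seq {P Q : Prog} {σ σ₁ σ₂ : Store} {t₁ t₂ : ℕ} {qs₁ qs₂ : List Data} :
      Exec O P σ σ₁ t₁ qs₁ → Exec O Q σ₁ σ₂ t₂ qs₂ →
      Exec O (.seq P Q) σ σ₂ (t₁ + t₂) (qs₁ ++ qs₂)
  | ite_true {e : Expr} {P Q : Prog} {σ σ₁ : Store} {t : ℕ} {qs : List Data} :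
      e.eval σ ≠ .nat 0 → Exec O P σ σ₁ t qs →
      Exec O (.ite e P Q) σ σ₁ (e.cost σ + 1 + t) qs
  | ite_false {e : Expr} {P Q : Prog} {σ σ₁ : Store} {t : ℕ} {qs : List Data} :
      e.eval σ = .nat 0 → Exec O Q σ σ₁ t qs →
      Exec O (.ite e P Q) σ σ₁ (e.cost σ + 1 + t) qs
  | loop_true {e : Expr} {P : Prog} {σ σ₁ σ₂ : Store} {t₁ t₂ : ℕ} {qs₁ qs₂ : List Data} :
      e.eval σ ≠ .nat 0 → Exec O P σ σ₁ t₁ qs₁ → Exec O (.loop e P) σ₁ σ₂ t₂ qs₂ →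
      Exec O (.loop e P) σ σ₂ (e.cost σ + 1 + t₁ + t₂) (qs₁ ++ qs₂)
  | loop_false {e : Expr} {P : Prog} {σ : Store} :
      e.eval σ = .nat 0 → Exec O (.loop e P) σ σ (e.cost σ + 1) []

/-- With oracle `O` and on input `x`, the program `P` halts with output `y` after time `t`, having
asked the questions `qs`. Input and output are in variable `0`; the other variables start at `0`. -/
def Prog.Runs (P : Prog) (O : Data → Data) (x y : Data) (t : ℕ) (qs : List Data) : Prop :=
  ∃ σ' : Store, Exec O P (Function.update (fun _ => Data.nat 0) 0 x) σ' t qs ∧ σ' 0 = y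

/-! ### The maximum independent set problem -/

/-- `q` is a code of the graph `G`, the vertex `v` being called `name v`: the list of all vertices,
each once, paired with a list of the edges, each given by its two ends in either order. -/
def IsGraphCode {V : Type} (name : V → Data) (G : SimpleGraph V) (q : Data) : Prop :=
  ∃ (vs : List V) (es : List (V × V)),
    vs.Nodup ∧ (∀ v, v ∈ vs) ∧
    (∀ u v, G.Adj u v ↔ (u, v) ∈ es ∨ (v, u) ∈ es) ∧
    q = .cons (.ofList (vs.map name))
      (.ofList (es.map fun e => .cons (name e.1) (name e.2)))

/-- The oracle `O` solves the optimization variant of the maximum independent set problem: to a code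
of a finite simple graph it answers with a list, without repetition, of the vertices of some
maximum independent set of this graph. -/
def SolvesMISP (O : Data → Data) : Prop :=
  ∀ (V : Type) [Finite V] (name : V → Data) (G : SimpleGraph V) (q : Data),
    Function.Injective name → IsGraphCode name G q →
    ∃ (U : Finset V) (us : List V), G.IsMaximumIndepSet U ∧
      us.Nodup ∧ (∀ v, v ∈ us ↔ v ∈ U) ∧ O q = .ofList (us.map name)

/-! ### The broadcaster-repacking problem -/

/-- Interference and domain constraints: the stations `S`, the domains `D s` of the stations `s ∈ S`
(the values of `D` outside `S` are immaterial), and the interference constraints `I`, pairs of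
station-channel pairs. -/
structure Constraints where
  S : Finset ℕ
  D : ℕ → Finset ℕ
  I : Finset ((ℕ × ℕ) × (ℕ × ℕ))

namespace Constraints

/-- The set of channels, the union of the domains. -/
def C (B : Constraints) : Finset ℕ := B.S.biUnion B.D

/-- `I ⊆ (S × C)²`, and no interference constraint relates a station to itself. -/
structure Valid (B : Constraints) : Prop where
  subset : B.I ⊆ (B.S ×ˢ B.C) ×ˢ (B.S ×ˢ B.C)
  station_ne : ∀ i ∈ B.I, i.1.1 ≠ i.2.1

/-- The complete, feasible assignments. -/
def feasibleSet (B : Constraints) : Set (B.S → ℕ) :=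
  {f | (∀ s : B.S, f s ∈ B.D s) ∧
    ∀ (s₁ s₂ : B.S) (c₁ c₂ : ℕ), (((s₁ : ℕ), c₁), ((s₂ : ℕ), c₂)) ∈ B.I → f s₁ = c₁ → f s₂ ≠ c₂}

/-- The cost of a complete assignment: the maximum assigned channel. -/
def cost (B : Constraints) (f : B.S → ℕ) : ℕ := Finset.univ.sup f

/-- The optimal assignments: the feasible ones of minimum cost. -/
def optimalSet (B : Constraints) : Set (B.S → ℕ) :=
  {f | f ∈ B.feasibleSet ∧ IsMinOn B.cost B.feasibleSet f}

/-- The subproblem with clearing target `c`: every domain is cut down to its channels `≤ c`. -/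
def clear (B : Constraints) (c : ℕ) : Constraints where
  S := B.S
  D s := (B.D s).filter (· ≤ c)
  I := B.I

/-- The vertices of the constraint graph: the station-channel pairs allowed by the domains. -/
def vertices (B : Constraints) : Finset (ℕ × ℕ) := (B.S ×ˢ B.C).filter fun p => p.2 ∈ B.D p.1

/-- The constraint graph: distinct vertices are adjacent when they belong to the same station (at-most
constraints) or share an interference constraint. -/
def graph (B : Constraints) : SimpleGraph B.vertices where
  Adj u v := u ≠ v ∧ (u.1.1 = v.1.1 ∨ (u.1, v.1) ∈ B.I ∨ (v.1, u.1) ∈ B.I)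
  symm := ⟨fun u v h => ⟨h.1.symm, by rcases h.2 with h | h | h <;> simp [h]⟩⟩
  loopless := ⟨fun _ h => h.1 rfl⟩

end Constraints

/-- A station-channel pair as a value. -/
def pairCode (p : ℕ × ℕ) : Data := .cons (.nat p.1) (.nat p.2)

namespace Constraints

/-- `x` is a code of the input data `(I, D)`: a list of the interference constraints, paired with the
list of all stations, each once, along with its domain, listed without repetition. The order of
listing is arbitrary. -/
def IsCode (B : Constraints) (x : Data) : Prop :=
  ∃ (is : List ((ℕ × ℕ) × (ℕ × ℕ))) (ss : List ℕ) (dom : ℕ → List ℕ),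
    (∀ i, i ∈ is ↔ i ∈ B.I) ∧
    ss.Nodup ∧ (∀ s, s ∈ ss ↔ s ∈ B.S) ∧
    (∀ s ∈ ss, (dom s).Nodup ∧ ∀ c, c ∈ dom s ↔ c ∈ B.D s) ∧
    x = .cons (.ofList (is.map fun i => .cons (pairCode i.1) (pairCode i.2)))
      (.ofList (ss.map fun s => .cons (.nat s) (.ofList ((dom s).map .nat))))

/-- `y` is a code of the assignment `f`: the list of all pairs `(s, f s)`, each once. -/
def IsAssignmentCode (B : Constraints) (f : B.S → ℕ) (y : Data) : Prop :=
  ∃ ss : List B.S, ss.Nodup ∧ (∀ s, s ∈ ss) ∧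
    y = .ofList (ss.map fun s : B.S => pairCode ((s : ℕ), f s))

/-- `y` is a correct answer to the optimization variant: the one-element list that holds a code of an
optimal assignment if there is a feasible one, and the empty list if there is none. -/
def IsAnswer (B : Constraints) (y : Data) : Prop :=
  (∃ f ∈ B.optimalSet, ∃ z, B.IsAssignmentCode f z ∧ y = .ofList [z]) ∨
    (B.feasibleSet = ∅ ∧ y = .ofList [])

end Constraints

end BRP

namespace BRP

open Polynomial

/-! In the constraint graph the vertices of one station are pairwise adjacent, so an independent set
has at most |S| members, and one with |S| members chooses a channel for every station without
violating a constraint. Thus feasibility means independence number |S|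
(`Constraints.feasibleSet_nonempty_iff`), and the oracle's list is then itself the code of an
assignment. Cutting the domains at c keeps exactly the feasible assignments of cost at most c
(`Constraints.mem_feasibleSet_clear`), and a cost is a channel unless S is empty. So the optimum is
found by binary search over C: asking about the median halves the candidates (`exists_median_eq`),
which gives at most log₂|C| + 1 calls, and `SearchInv` is the invariant.

For the running time, `PolyTime` is shown to be closed under composition, pairing, branching and
folds over lists, the latter when a step enlarges the accumulator by an amount that does not depend
on it (`PolyTime.foldl`). All work between oracle calls is composed of these; only the search loop
is a program treated directly (`exec_searchLoop`). Its states stay of polynomial size because an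
answer is no larger than its question (`SolvesMISP.answer`) and replaces the previous one. -/

theorem monotone_polynomial_eval (p : ℕ[X]) : Monotone fun n => p.eval n := by
  intro a b h
  induction p using Polynomial.induction_on' with
  | add p q hp hq => simpa using add_le_add hp hq
  | monomial n c => simpa using Nat.mul_le_mul_left c (Nat.pow_le_pow_left h n)

theorem eval_le_eval (p : ℕ[X]) {a b : ℕ} (h : a ≤ b) : p.eval a ≤ p.eval b :=
  monotone_polynomial_eval p h

/-! ### Sizes of values. -/

namespace Data

theorem size_pos (d : Data) : 0 < d.size := by cases d <;> simp [size]

theorem size_hd_le (d : Data) : d.hd.size ≤ d.size := by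
  cases d <;> simp only [hd, size, Nat.size_zero] <;> omega

theorem size_tl_le (d : Data) : d.tl.size ≤ d.size := by
  cases d <;> simp only [tl, size, Nat.size_zero] <;> omega

@[simp] theorem hd_cons (a b : Data) : (cons a b).hd = a := rfl

@[simp] theorem tl_cons (a b : Data) : (cons a b).tl = b := rfl

/-- The values along the right spine; inverse to `ofList` on codes of lists. -/
def toList : Data → List Data
  | nat _ => []
  | cons a b => a :: b.toList

@[simp] theorem toList_ofList (l : List Data) : (ofList l).toList = l := by
  induction l with
  | nil => rfl
  | cons a l ih => simp [ofList, toList, ih]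

theorem ofList_injective : Function.Injective ofList :=
  Function.LeftInverse.injective toList_ofList

theorem size_ofList (l : List Data) : (ofList l).size = (l.map fun a => a.size + 1).sum + 1 := by
  induction l with
  | nil => simp [ofList, size]
  | cons a l ih => simp [ofList, size, ih]; omega

theorem size_ofList_toList_le (d : Data) : (ofList d.toList).size ≤ d.size := by
  induction d with
  | nat n => simp [toList, ofList, size]
  | cons a b _ ih => simp only [toList, ofList, size]; omega

theorem length_toList_le (d : Data) : d.toList.length ≤ d.size := by
  induction d with
  | nat n => simp [toList]
  | cons a b _ ih => simp only [toList, List.length_cons, size]; omega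

theorem size_le_of_mem_toList {a d : Data} (h : a ∈ d.toList) : a.size ≤ d.size := by
  induction d with
  | nat n => simp [toList] at h
  | cons b c _ ih =>
    simp only [toList, List.mem_cons] at h
    simp only [size]
    rcases h with rfl | h
    · omega
    · have := ih h; omega

end Data

theorem size_add_le (a b : ℕ) : Nat.size (a + b) ≤ Nat.size a + Nat.size b + 1 := by
  rw [Nat.size_le]
  have ha := Nat.lt_size_self a
  have hb := Nat.lt_size_self b
  have h1 : 2 ^ Nat.size a ≤ 2 ^ (Nat.size a + Nat.size b) :=
    Nat.pow_le_pow_right (by norm_num) (by omega)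
  have h2 : 2 ^ Nat.size b ≤ 2 ^ (Nat.size a + Nat.size b) :=
    Nat.pow_le_pow_right (by norm_num) (by omega)
  rw [pow_succ]
  omega

theorem Data.size_nat_ite_le (c : Prop) [Decidable c] :
    (Data.nat (if c then 1 else 0)).size ≤ 2 := by
  split <;> simp [size]

theorem Data.size_nat_toNat_le (d : Data) : (Data.nat d.toNat).size ≤ d.size := by
  cases d <;> simp [toNat, size]

/-! ### Polynomial-time functions and their closure properties. -/

/-- `P` replaces the contents `x` of variable `0` by `f x`, without oracle calls and in time at most
`p`, and restores the contents of variable `1`, which serves as a stack. -/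
def Prog.Computes (P : Prog) (f : Data → Data) (p : ℕ[X]) : Prop :=
  ∀ (O : Data → Data) (σ : Store), ∃ (σ' : Store) (t : ℕ), Exec O P σ σ' t [] ∧
    σ' 0 = f (σ 0) ∧ σ' 1 = σ 1 ∧ t ≤ p.eval ((σ 0).size + (σ 1).size)

/-- `f` is computed in polynomial time without oracle calls. -/
def PolyTime (f : Data → Data) : Prop :=
  ∃ (P : Prog) (p q : ℕ[X]), P.Computes f p ∧ ∀ x, (f x).size ≤ q.eval x.size

namespace PolyTime

variable {f g h : Data → Data}

protected theorem id : PolyTime fun x => x :=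
  ⟨.skip, 1, X, fun _ σ => ⟨σ, 1, .skip σ, rfl, rfl, by simp⟩, by simp⟩

theorem comp (hg : PolyTime g) (hf : PolyTime f) : PolyTime fun x => g (f x) := by
  obtain ⟨P, p, q, hP, hq⟩ := hf
  obtain ⟨P', p', q', hP', hq'⟩ := hg
  -- The second program starts on a value of size at most `q`, with the stack restored; this is why
  -- `PolyTime` also bounds the size of the output.
  refine ⟨.seq P P', p + p'.comp (q + X), q'.comp q, fun O σ => ?_, fun x => ?_⟩
  · obtain ⟨σ₁, t₁, e₁, h₀, h₁, ht₁⟩ := hP O σ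
    obtain ⟨σ₂, t₂, e₂, h₀', h₁', ht₂⟩ := hP' O σ₁
    refine ⟨σ₂, _, .seq e₁ e₂, by rw [h₀', h₀], by rw [h₁', h₁], ?_⟩
    simp only [eval_add, eval_comp, eval_X]
    refine add_le_add ht₁ (ht₂.trans (eval_le_eval _ ?_))
    rw [h₀, h₁]
    exact add_le_add ((hq _).trans (eval_le_eval _ (by omega))) (by omega)
  · simpa using (hq' _).trans (eval_le_eval _ (hq x))

theorem of_expr (e : Expr) (p q : ℕ[X]) (he : ∀ σ : Store, e.eval σ = f (σ 0))
    (hc : ∀ σ : Store, e.cost σ ≤ p.eval (σ 0).size) (hq : ∀ x, (f x).size ≤ q.eval x.size) :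
    PolyTime f := by
  refine ⟨.assign 0 e, p + 1, q, fun O σ => ⟨_, _, .assign 0 e σ, ?_, ?_, ?_⟩, hq⟩
  · simp [he]
  · simp
  · simpa using (hc σ).trans (eval_le_eval _ (by omega))

theorem const (n : ℕ) : PolyTime fun _ => .nat n :=
  of_expr (.const n) (C (Data.nat n).size) (C (Data.nat n).size) (fun _ => rfl)
    (by simp [Expr.cost]) (by simp)

theorem hd (hf : PolyTime f) : PolyTime fun x => (f x).hd := by
  refine comp (of_expr (.hd (.var 0)) (2 * X) X (fun _ => rfl) (fun σ => ?_) fun x => ?_) hf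
  · have := (σ 0).size_hd_le
    simp [Expr.cost, Expr.eval]; omega
  · simpa using x.size_hd_le

theorem tl (hf : PolyTime f) : PolyTime fun x => (f x).tl := by
  refine comp (of_expr (.tl (.var 0)) (2 * X) X (fun _ => rfl) (fun σ => ?_) fun x => ?_) hf
  · have := (σ 0).size_tl_le
    simp [Expr.cost, Expr.eval]; omega
  · simpa using x.size_tl_le

theorem pair (hf : PolyTime f) (hg : PolyTime g) : PolyTime fun x => .cons (f x) (g x) := by
  obtain ⟨P, p, q, hP, hq⟩ := hf
  obtain ⟨P', p', q', hP', hq'⟩ := hg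
  -- The input is pushed on the stack while `P` runs, then replaced there by the value of `f` while
  -- `P'` runs. Variable 2 is needed only for this exchange, so the programs may overwrite it. The
  -- extra stack entry accounts for the arguments of `p` and `p'`.
  refine ⟨.seq (.assign 1 (.cons (.var 0) (.var 1))) <| .seq P <| .seq (.assign 2 (.var 0)) <|
    .seq (.assign 0 (.hd (.var 1))) <| .seq (.assign 1 (.cons (.var 2) (.tl (.var 1)))) <|
    .seq P' <| .seq (.assign 0 (.cons (.hd (.var 1)) (.var 0))) (.assign 1 (.tl (.var 1))),
    p.comp (2 * X + 1) + p'.comp (q + 2 * X + 1) + 20 * X + 20 * q + 20 * q' + 40,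
    q + q' + 1, fun O σ => ?_, fun x => ?_⟩
  · obtain ⟨σ₁, t₁, e₁, h₀, h₁, ht₁⟩ := hP O
      (Function.update σ 1 ((Expr.cons (.var 0) (.var 1)).eval σ))
    simp only [Expr.eval, ne_eq, zero_ne_one, not_false_eq_true, Function.update_of_ne,
      Function.update_self, Data.size] at h₀ h₁ ht₁
    set σ₂ := Function.update (Function.update (Function.update σ₁ 2 (σ₁ 0)) 0 (σ₁ 1).hd) 1
      (.cons (σ₁ 0) (σ₁ 1).tl) with hσ₂
    obtain ⟨σ₃, t₃, e₃, h₀', h₁', ht₃⟩ := hP' O σ₂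
    have a₀ : σ₂ 0 = σ 0 := by simp [hσ₂, h₁, Data.hd]
    have a₁ : σ₂ 1 = .cons (f (σ 0)) (σ 1) := by simp [hσ₂, h₁, h₀, Data.tl]
    rw [a₀] at h₀'
    rw [a₁] at h₁'
    rw [a₀, a₁] at ht₃
    refine ⟨_, _, .seq (.assign _ _ _) <| .seq e₁ <| .seq (.assign _ _ _) <|
      .seq (.assign _ _ _) <| .seq (.assign _ _ _) <| .seq (?_ : Exec O P' _ σ₃ t₃ []) <|
      .seq (.assign _ _ _) (.assign _ _ _), ?_, ?_, ?_⟩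
    · convert e₃ using 1
      simp [hσ₂, Expr.eval]
    · simp [Expr.eval, h₀', h₁', Data.hd]
    · simp [Expr.eval, h₁', Data.tl]
    · have b₁ := hq (σ 0)
      have b₂ := hq' (σ 0)
      have b₃ := eval_le_eval q (Nat.le_add_right (σ 0).size (σ 1).size)
      have b₄ := eval_le_eval q' (Nat.le_add_right (σ 0).size (σ 1).size)
      simp only [Data.size] at ht₃
      have b₅ := ht₁.trans (eval_le_eval p (b := 2 * ((σ 0).size + (σ 1).size) + 1) (by omega))
      have b₆ := ht₃.trans (eval_le_eval p' (b := q.eval ((σ 0).size + (σ 1).size) +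
        2 * ((σ 0).size + (σ 1).size) + 1) (by omega))
      simp [Expr.cost, Expr.eval, h₀, h₁, h₀', h₁', Data.hd, Data.tl, Data.size]
      omega
  · have := hq x
    have := hq' x
    simp [Data.size]; omega

theorem pairing_expr (e : Expr → Expr → Expr) (F : Data → Data → Data) (k : ℕ)
    (he : ∀ e₁ e₂ σ, (e e₁ e₂).eval σ = F (e₁.eval σ) (e₂.eval σ))
    (hc : ∀ e₁ e₂ σ, (e e₁ e₂).cost σ = e₁.cost σ + e₂.cost σ + ((e e₁ e₂).eval σ).size)
    (hF : ∀ a b, (F a b).size ≤ a.size + b.size + k)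
    (hf : PolyTime f) (hg : PolyTime g) : PolyTime fun x => F (f x) (g x) := by
  refine comp (f := fun x => .cons (f x) (g x)) (g := fun x => F x.hd x.tl) ?_ (pair hf hg)
  refine of_expr (e (.hd (.var 0)) (.tl (.var 0))) (10 * X + C k) (2 * X + C k)
    (fun σ => ?_) (fun σ => ?_) fun x => ?_
  · simp [he, Expr.eval]
  · have := hF (σ 0).hd (σ 0).tl
    have := (σ 0).size_hd_le
    have := (σ 0).size_tl_le
    simp [hc, he, Expr.cost, Expr.eval]
    omega
  · have := hF x.hd x.tl
    have := x.size_hd_le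
    have := x.size_tl_le
    simp; omega

theorem add (hf : PolyTime f) (hg : PolyTime g) :
    PolyTime fun x => .nat ((f x).toNat + (g x).toNat) := by
  refine pairing_expr .add (fun a b => .nat (a.toNat + b.toNat)) 1 (fun _ _ _ => rfl)
    (fun _ _ _ => rfl) (fun a b => ?_) hf hg
  have := size_add_le a.toNat b.toNat
  have := a.size_nat_toNat_le
  have := b.size_nat_toNat_le
  simp only [Data.size] at *
  omega

theorem lt (hf : PolyTime f) (hg : PolyTime g) :
    PolyTime fun x => .nat (if (f x).toNat < (g x).toNat then 1 else 0) := by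
  refine pairing_expr .lt (fun a b => .nat (if a.toNat < b.toNat then 1 else 0)) 1
    (fun _ _ _ => rfl) (fun _ _ _ => rfl) (fun a b => ?_) hf hg
  have := a.size_pos
  have := Data.size_nat_ite_le (a.toNat < b.toNat)
  omega

theorem eq (hf : PolyTime f) (hg : PolyTime g) :
    PolyTime fun x => .nat (if f x = g x then 1 else 0) := by
  refine pairing_expr .eq (fun a b => .nat (if a = b then 1 else 0)) 1
    (fun _ _ _ => rfl) (fun _ _ _ => rfl) (fun a b => ?_) hf hg
  have := a.size_pos
  have := Data.size_nat_ite_le (a = b)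
  omega

/-- The test would overwrite the input, so its value is first paired with the input and each branch
begins by projecting. -/
theorem ite_ne (hf : PolyTime f) (hg : PolyTime g) (hh : PolyTime h) :
    PolyTime fun x => if f x ≠ .nat 0 then g x else h x := by
  refine comp (f := fun x => .cons (f x) x)
    (g := fun x => if x.hd ≠ .nat 0 then g x.tl else h x.tl) ?_ (pair hf .id)
  obtain ⟨P, p, q, hP, hq⟩ := hg.comp (tl .id)
  obtain ⟨P', p', q', hP', hq'⟩ := hh.comp (tl .id)
  refine ⟨.ite (.hd (.var 0)) P P', p + p' + 2 * X + 1, q + q', fun O σ => ?_, fun x => ?_⟩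
  · have hs := (σ 0).size_hd_le
    by_cases hx : (σ 0).hd = .nat 0
    · obtain ⟨σ', t, e, h₀, h₁, ht⟩ := hP' O σ
      refine ⟨σ', _, .ite_false hx e, by simp [hx, h₀], h₁, ?_⟩
      simp [Expr.cost, Expr.eval]; omega
    · obtain ⟨σ', t, e, h₀, h₁, ht⟩ := hP O σ
      refine ⟨σ', _, .ite_true hx e, by simp [hx, h₀], h₁, ?_⟩
      simp [Expr.cost, Expr.eval]; omega
  · have := hq x
    have := hq' x
    dsimp only at *
    split <;> simp <;> omega

/-- A function whose values are the truth values of `c`. -/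
def Decides (c : Data → Prop) : Prop :=
  ∃ b : Data → Data, PolyTime b ∧ ∀ x, b x ≠ .nat 0 ↔ c x

variable {c d : Data → Prop}

theorem ite [DecidablePred c] (hc : Decides c) (hg : PolyTime g) (hh : PolyTime h) :
    PolyTime fun x => if c x then g x else h x := by
  obtain ⟨b, hb, hbc⟩ := hc
  simpa only [hbc] using ite_ne hb hg hh

theorem decides_lt (hf : PolyTime f) (hg : PolyTime g) :
    Decides fun x => (f x).toNat < (g x).toNat :=
  ⟨_, lt hf hg, by simp⟩

theorem decides_eq (hf : PolyTime f) (hg : PolyTime g) : Decides fun x => f x = g x :=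
  ⟨_, eq hf hg, by simp⟩

theorem Decides.not (hc : Decides c) : Decides fun x => ¬ c x := by
  classical
  exact ⟨_, ite hc (const 0) (const 1), by simp⟩

theorem Decides.and (hc : Decides c) (hd : Decides d) : Decides fun x => c x ∧ d x := by
  classical
  exact ⟨_, ite hc (ite hd (const 1) (const 0)) (const 0), by
    intro x; by_cases c x <;> by_cases d x <;> simp [*]⟩

theorem Decides.or (hc : Decides c) (hd : Decides d) : Decides fun x => c x ∨ d x := by
  classical
  exact ⟨_, ite hc (const 1) (ite hd (const 1) (const 0)), by
    intro x; by_cases c x <;> by_cases d x <;> simp [*]⟩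

end PolyTime

/-! ### Loops over lists. -/

/-- The test whether the value of an expression is a pair. -/
def Expr.isCons (e : Expr) : Expr := .eq e (.cons (.hd e) (.tl e))

/-- A pair is rebuilt from its projections, whereas rebuilding a leaf yields a pair and so never the
leaf. -/
theorem Expr.eval_isCons_ne {σ : Store} {e : Expr} {a b : Data} (h : e.eval σ = .cons a b) :
    e.isCons.eval σ ≠ .nat 0 := by
  simp [isCons, eval, h, Data.hd, Data.tl]

theorem Expr.eval_isCons_eq {σ : Store} {e : Expr} {n : ℕ} (h : e.eval σ = .nat n) :
    e.isCons.eval σ = .nat 0 := by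
  simp [isCons, eval, h]

theorem Expr.cost_isCons_le (σ : Store) (e : Expr) : e.isCons.cost σ ≤ 7 * e.cost σ + 6 := by
  have h : (e.eval σ).size ≤ e.cost σ := by cases e <;> simp [cost, eval]
  have h₁ := (e.eval σ).size_hd_le
  have h₂ := (e.eval σ).size_tl_le
  have h₃ : (e.isCons.eval σ).size ≤ 2 := Data.size_nat_ite_le _
  simp only [isCons, eval] at h₃
  simp only [isCons, cost, eval, Data.size] at h₃ ⊢
  omega

/-- The component of the state of a loop that holds the list still to be processed. -/
def Expr.pending : Expr := .hd (.tl (.var 0))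

theorem Expr.cost_isCons_pending_le (σ : Store) :
    pending.isCons.cost σ ≤ 21 * (σ 0).size + 6 := by
  have := cost_isCons_le σ pending
  have h₁ := (σ 0).size_tl_le
  have h₂ := (σ 0).tl.size_hd_le
  simp only [pending, cost, eval] at *
  omega

namespace PolyTime

variable {f g h l i : Data → Data} {F : Data → Data → Data → Data}

/-- The state is the triple of parameter, pending list and accumulator. Each remaining element adds
at most `r.eval m`, so the current size plus this allowance for all pending elements never
increases; hence one bound `M` serves every round. -/
theorem exec_foldl_loop {P : Prog} {p r : ℕ[X]}
    (hP : P.Computes (fun s => .cons s.hd (.cons s.tl.hd.tl (F s.hd s.tl.hd.hd s.tl.tl))) p)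
    (hr : ∀ x a acc, (F x a acc).size ≤ acc.size + r.eval (x.size + a.size))
    (O : Data → Data) (m M : ℕ) (L : Data) : ∀ σ : Store, (σ 0).tl.hd = L →
      (σ 0).size + L.toList.length * r.eval m ≤ M → (σ 0).hd.size + L.size ≤ m →
      ∃ (σ' : Store) (t : ℕ), Exec O (.loop Expr.pending.isCons P) σ σ' t [] ∧
        (σ' 0).tl.tl = L.toList.foldl (fun acc a => F (σ 0).hd a acc) (σ 0).tl.tl ∧
        σ' 1 = σ 1 ∧ (σ' 0).size ≤ M ∧
        t ≤ (L.toList.length + 1) * (p.eval (M + (σ 1).size) + 21 * M + 7) := by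
  induction L with
  | nat n =>
    intro σ h₀ hM hm
    refine ⟨σ, _, .loop_false (Expr.eval_isCons_eq (e := .pending) h₀), rfl, rfl, by omega, ?_⟩
    have := Expr.cost_isCons_pending_le σ
    simp [Data.toList] at hM ⊢
    omega
  | cons a L _ ih =>
    intro σ h₀ hM hm
    obtain ⟨σ₁, t₁, e₁, h₁, h₁', ht₁⟩ := hP O σ
    dsimp only at h₁
    rw [h₀] at h₁
    simp only [Data.toList, Data.hd_cons, Data.tl_cons, List.length_cons, Data.size] at hM hm h₁
    have hF := hr (σ 0).hd a (σ 0).tl.tl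
    have hF' := eval_le_eval r (a := (σ 0).hd.size + a.size) (b := m) (by omega)
    -- Projections of leaves are leaves, so `h₀` forces the state to be a nested pair.
    have hs : (σ 0).size = (σ 0).hd.size + (a.size + L.size + 1 + (σ 0).tl.tl.size + 1) + 1 := by
      revert h₀
      rcases σ 0 with _ | ⟨_, _ | ⟨_, _⟩⟩ <;> simp [Data.hd, Data.tl]
      rintro rfl
      simp [Data.size]
    rw [Nat.add_mul] at hM
    obtain ⟨σ₂, t₂, e₂, h₂, h₂', hs₂, ht₂⟩ := ih σ₁ (by rw [h₁]; rfl)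
      (by simp only [h₁, Data.size]; omega) (by simp only [h₁, Data.hd_cons]; omega)
    refine ⟨σ₂, _, .loop_true (Expr.eval_isCons_ne (e := .pending) h₀) e₁ e₂, ?_, by rw [h₂', h₁'], hs₂, ?_⟩
    · rw [h₂, h₁]; rfl
    · have hc := Expr.cost_isCons_pending_le σ
      have := ht₁.trans (eval_le_eval p (b := M + (σ 1).size) (by omega))
      rw [h₁'] at ht₂
      simp only [Data.toList, List.length_cons]
      rw [Nat.add_mul (L.toList.length + 1)]
      omega

theorem foldl (hl : PolyTime l) (hi : PolyTime i)
    (hF : PolyTime fun y => F y.hd y.tl.hd y.tl.tl) (r : ℕ[X])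
    (hr : ∀ x a acc, (F x a acc).size ≤ acc.size + r.eval (x.size + a.size)) :
    PolyTime fun x => (l x).toList.foldl (fun acc a => F x a acc) (i x) := by
  refine comp (f := fun x => .cons x (.cons (l x) (i x)))
    (g := fun s => s.tl.hd.toList.foldl (fun acc a => F s.hd a acc) s.tl.tl) ?_
    (pair .id (pair hl hi))
  have id := PolyTime.id
  have hb : PolyTime fun s => .cons s.hd (.cons s.tl.hd.tl (F s.hd s.tl.hd.hd s.tl.tl)) :=
    pair id.hd (pair id.tl.hd.tl (comp hF (pair id.hd (pair id.tl.hd.hd id.tl.tl))))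
  obtain ⟨P, p, q, hP, -⟩ := hb
  -- There are at most as many rounds as the size of the state, and parameter and element together
  -- have at most twice that size.
  let M : ℕ[X] := X + X * r.comp (2 * X)
  have hM (s : Data) : s.size + s.tl.hd.toList.length * r.eval (2 * s.size) ≤ M.eval s.size := by
    simp only [M, eval_add, eval_X, eval_mul, eval_comp, eval_ofNat]
    gcongr
    exact (Data.length_toList_le _).trans ((Data.size_hd_le _).trans (Data.size_tl_le _))
  have hm (s : Data) : s.hd.size + s.tl.hd.size ≤ 2 * s.size := by
    have := s.size_hd_le
    have := s.tl.size_hd_le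
    have := s.size_tl_le
    omega
  refine ⟨.seq (.loop Expr.pending.isCons P) (.assign 0 (.tl (.tl (.var 0)))),
    (X + 1) * (p.comp (M + X) + 21 * M + 7) + 3 * M + 1, M, fun O σ => ?_, fun s => ?_⟩
  · obtain ⟨σ₁, t, e, h₀, h₁, hs, ht⟩ :=
      exec_foldl_loop hP hr O _ _ _ σ rfl (hM (σ 0)) (hm (σ 0))
    refine ⟨_, _, .seq e (.assign _ _ _), by simp [Expr.eval, h₀], by simp [h₁], ?_⟩
    have h₂ := (σ₁ 0).size_tl_le
    have h₃ := (σ₁ 0).tl.size_tl_le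
    have h₄ := eval_le_eval M (Nat.le_add_right (σ 0).size (σ 1).size)
    have h₅ : (σ 0).tl.hd.toList.length ≤ (σ 0).size + (σ 1).size :=
      ((Data.length_toList_le _).trans ((Data.size_hd_le _).trans (Data.size_tl_le _))).trans
        (Nat.le_add_right _ _)
    have h₆ : t ≤ ((σ 0).size + (σ 1).size + 1) *
        (p.eval (M.eval ((σ 0).size + (σ 1).size) + ((σ 0).size + (σ 1).size)) +
          21 * M.eval ((σ 0).size + (σ 1).size) + 7) := by
      refine ht.trans (Nat.mul_le_mul (by omega) ?_)
      have := eval_le_eval p (a := M.eval (σ 0).size + (σ 1).size)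
        (b := M.eval ((σ 0).size + (σ 1).size) + ((σ 0).size + (σ 1).size)) (by omega)
      omega
    simp only [eval_add, eval_mul, eval_comp, eval_X, eval_ofNat, eval_one, Expr.cost, Expr.eval]
    omega
  · refine le_trans ?_ (hM s)
    suffices ∀ (L : List Data) (acc : Data), (∀ a ∈ L, a.size ≤ s.size) →
        (L.foldl (fun acc a => F s.hd a acc) acc).size ≤
          acc.size + L.length * r.eval (2 * s.size) by
      refine (this _ _ fun a ha => ?_).trans
        (Nat.add_le_add_right ((Data.size_tl_le _).trans (Data.size_tl_le _)) _)
      exact (Data.size_le_of_mem_toList ha).trans ((Data.size_hd_le _).trans (Data.size_tl_le _))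
    intro L
    induction L with
    | nil => simp
    | cons a L ih =>
      intro acc ha
      have h₁ := ih (F s.hd a acc) fun b hb => ha b (by simp [hb])
      have h₂ := hr s.hd a acc
      have h₃ := ha a (by simp)
      have h₄ := eval_le_eval r (a := s.hd.size + a.size) (b := 2 * s.size)
        (by have := s.size_hd_le; omega)
      simp only [List.foldl_cons, List.length_cons, Nat.add_mul]
      omega

end PolyTime

/-! ### Polynomial-time operations on lists. -/

theorem Data.foldl_cons (L b : List Data) :
    L.foldl (fun acc a => .cons a acc) (ofList b) = ofList (L.reverse ++ b) := by
  induction L generalizing b with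
  | nil => rfl
  | cons a L ih => simpa [ofList] using ih (a :: b)

/-- `f` is computed in polynomial time without oracle calls, lists being coded as values. -/
def PolyTimeList (f : Data → List Data) : Prop := PolyTime fun x => .ofList (f x)

namespace PolyTimeList

open Data

variable {g : Data → Data} {f l : Data → List Data} {F : Data → Data → List Data}
  {c : Data → Data → Prop}

theorem nil : PolyTimeList fun _ => [] := PolyTime.const 0

theorem cons (hg : PolyTime g) (hl : PolyTimeList l) : PolyTimeList fun x => g x :: l x :=
  PolyTime.pair hg hl

theorem comp (hl : PolyTimeList l) (hg : PolyTime g) : PolyTimeList fun x => l (g x) :=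
  PolyTime.comp (g := fun x => .ofList (l x)) hl hg

theorem reverse_append (hf : PolyTimeList f) (hl : PolyTimeList l) :
    PolyTimeList fun x => (f x).reverse ++ l x := by
  have id := PolyTime.id
  have := PolyTime.foldl hf hl (F := fun _ a acc => .cons a acc) (id.tl.hd.pair id.tl.tl)
    (X + 1) (by intros; simp [size]; omega)
  simpa only [PolyTimeList, toList_ofList, foldl_cons] using this

theorem reverse (hf : PolyTimeList f) : PolyTimeList fun x => (f x).reverse := by
  simpa using reverse_append hf nil

/-- Not the identity on values: the leaf that ends the spine becomes `0`. The fold reverses the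
list, so a second reversal follows. -/
theorem toList (hg : PolyTime g) : PolyTimeList fun x => (g x).toList := by
  have id := PolyTime.id
  have := PolyTime.foldl hg nil (F := fun _ a acc => .cons a acc) (id.tl.hd.pair id.tl.tl)
    (X + 1) (by intros; simp [size]; omega)
  simp only [foldl_cons, List.append_nil] at this
  simpa using reverse this

theorem flatMap (hl : PolyTimeList l) (hF : PolyTimeList fun y => F y.hd y.tl) :
    PolyTimeList fun x => (l x).flatMap (F x) := by
  have id := PolyTime.id
  have hb : PolyTimeList fun y => (F y.hd y.tl.hd).reverse ++ y.tl.tl.toList :=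
    reverse_append (comp hF (id.hd.pair id.tl.hd)) (toList id.tl.tl)
  obtain ⟨-, -, q, -, hq⟩ := hF
  have := PolyTime.foldl hl nil (F := fun x a acc => .ofList ((F x a).reverse ++ acc.toList)) hb
    -- The pair of `x` and `a` has one symbol more than its components; reading `acc` as a list does
    -- not enlarge it.
    (q.comp (X + 1)) fun x a acc => by
      have h₁ := hq (.cons x a)
      have h₂ := acc.size_ofList_toList_le
      simp [size, hd, tl, size_ofList] at *
      omega
  have key (x : Data) (L b : List Data) :
      L.foldl (fun acc a => .ofList ((F x a).reverse ++ acc.toList)) (ofList b) =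
        .ofList ((L.flatMap (F x)).reverse ++ b) := by
    induction L generalizing b with
    | nil => simp
    | cons a L ih => simp [ih]
  simp only [toList_ofList, key, List.append_nil] at this
  simpa using reverse this

theorem map {G : Data → Data → Data} (hl : PolyTimeList l) (hG : PolyTime fun y => G y.hd y.tl) :
    PolyTimeList fun x => (l x).map (G x) := by
  simpa only [List.map_eq_flatMap] using
    flatMap hl (F := fun x a => [G x a]) (cons hG nil)

theorem ite {c : Data → Prop} [DecidablePred c] (hc : PolyTime.Decides c) (hf : PolyTimeList f)
    (hl : PolyTimeList l) : PolyTimeList fun x => if c x then f x else l x := by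
  simpa only [PolyTimeList, apply_ite] using PolyTime.ite hc hf hl

theorem filter [∀ x, DecidablePred (c x)] (hl : PolyTimeList l) (hc : PolyTime.Decides fun y => c y.hd y.tl) :
    PolyTimeList fun x => (l x).filter fun a => c x a := by
  convert flatMap hl (F := fun x a => if c x a then [a] else [])
    (ite hc (cons (PolyTime.id.tl) nil) nil) using 2 with x
  induction l x with
  | nil => rfl
  | cons a L ih => by_cases h : c x a <;> simp [h, ih]

theorem decides_exists (hl : PolyTimeList l) (hc : PolyTime.Decides fun y => c y.hd y.tl) :
    PolyTime.Decides fun x => ∃ a ∈ l x, c x a := by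
  classical
  -- The filtered list is its own truth value, since the empty list is coded by `0`.
  refine ⟨_, filter hl hc, fun x => ?_⟩
  rw [← not_iff_not, not_not, show nat 0 = ofList [] from rfl, ofList_injective.eq_iff]
  simp

theorem decides_mem (hg : PolyTime g) (hl : PolyTimeList l) :
    PolyTime.Decides fun x => g x ∈ l x := by
  have id := PolyTime.id
  convert decides_exists hl (c := fun x a => a = g x)
    (PolyTime.decides_eq id.tl (hg.comp id.hd)) using 2 with x
  simp

theorem length (hl : PolyTimeList l) : PolyTime fun x => .nat (l x).length := by
  have id := PolyTime.id
  have := PolyTime.foldl hl (PolyTime.const 0) (F := fun _ _ acc => .nat (acc.toNat + 1))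
    (PolyTime.add id.tl.tl (PolyTime.const 1)) 3 fun x a acc => by
      have h₁ := size_add_le acc.toNat 1
      have h₂ := acc.size_nat_toNat_le
      simp [size] at *
      omega
  convert this using 2 with x
  rw [toList_ofList]
  suffices ∀ (L : List Data) n,
      L.foldl (fun acc _ => nat (acc.toNat + 1)) (nat n) = nat (n + L.length) by simp [this]
  intro L
  induction L with
  | nil => simp
  | cons a L ih => intro n; rw [List.foldl_cons, ih]; simp [Data.toNat]; omega

end PolyTimeList

/-- The list `acc`, extended by the members of `L` that it does not contain yet. -/
def insertAll (L acc : List Data) : List Data :=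
  L.foldl (fun acc a => if a ∈ acc then acc else a :: acc) acc

theorem nodup_insertAll {L acc : List Data} (h : acc.Nodup) : (insertAll L acc).Nodup := by
  induction L generalizing acc with
  | nil => exact h
  | cons a L ih =>
    refine ih ?_
    dsimp only
    split
    · exact h
    · simp [*]

theorem mem_insertAll {L acc : List Data} {b : Data} :
    b ∈ insertAll L acc ↔ b ∈ L ∨ b ∈ acc := by
  induction L generalizing acc with
  | nil => simp [insertAll]
  | cons a L ih =>
    rw [insertAll, List.foldl_cons, ← insertAll, ih]
    split <;> simp <;> grind

open Data in
theorem PolyTimeList.insertAll {l : Data → List Data} (hl : PolyTimeList l) :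
    PolyTimeList fun x => insertAll (l x) [] := by
  have id := PolyTime.id
  classical
  have hb : PolyTimeList fun y => if y.tl.hd ∈ y.tl.tl.toList then y.tl.tl.toList
      else y.tl.hd :: y.tl.tl.toList := by
    convert ite (decides_mem id.tl.hd (toList id.tl.tl)) (toList id.tl.tl)
      (cons id.tl.hd (toList id.tl.tl))
  have := PolyTime.foldl hl nil
    (F := fun _ a acc => .ofList (if a ∈ acc.toList then acc.toList else a :: acc.toList)) hb
    (X + 1) fun x a acc => by
      have h₂ := acc.size_ofList_toList_le
      split <;> simp [ofList, size] <;> omega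
  unfold PolyTimeList
  convert this using 2 with x
  rw [toList_ofList]
  beta_reduce
  generalize ([] : List Data) = acc
  generalize l x = L
  induction L generalizing acc with
  | nil => rfl
  | cons a L ih =>
    simp only [BRP.insertAll, List.foldl_cons, toList_ofList] at ih ⊢
    exact ih _

/-! ### The functions used by the binary search. -/

open Data

/-- The channels of an instance, each once. -/
def channels (x : Data) : List Data := insertAll (x.tl.toList.flatMap fun s => s.tl.toList) []

/-- The vertices of the constraint graph of the subproblem with clearing target `m`. -/
def vertexList (x m : Data) : List Data :=
  x.tl.toList.flatMap fun s =>
    (s.tl.toList.filter fun c => ¬ m.toNat < c.toNat).map fun c => .cons s.hd c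

/-- The edges of the constraint graph of the subproblem with clearing target `m`. -/
def edgeList (x m : Data) : List Data :=
  (vertexList x m).flatMap fun u =>
    ((vertexList x m).filter fun v => u.hd = v.hd ∧ u ≠ v ∨ .cons u v ∈ x.hd.toList).map
      fun v => .cons u v

/-- The oracle question that tests the feasibility of the subproblem with clearing target `m`. -/
def question (x m : Data) : Data := .cons (.ofList (vertexList x m)) (.ofList (edgeList x m))

/-- The median of a list of distinct numbers. -/
def median (L : List Data) : Data :=
  (ofList (L.filter fun m =>
    ¬ L.length < (L.filter fun c => c.toNat < m.toNat).length +
      (L.filter fun c => c.toNat < m.toNat).length ∧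
    L.length < (L.filter fun c => c.toNat < m.toNat).length +
      (L.filter fun c => c.toNat < m.toNat).length + 2)).hd

/-- The first state of the binary search: the input, the candidates for the optimal cost, and the
best answer known, which is the empty assignment if there are no stations. -/
def searchInit (x : Data) : Data :=
  .cons x (.cons (.ofList (channels x))
    (if x.tl = .nat 0 then .cons (.nat 0) (.nat 0) else .nat 0))

/-- The question put to the oracle in a state of the binary search. -/
def searchQuestion (s : Data) : Data := question s.hd (median s.tl.hd.toList)

/-- The next state of the binary search, after the answer `a` of the oracle. -/
def searchStep (s a : Data) : Data :=
  if a.toList.length = s.hd.tl.toList.length then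
    .cons s.hd (.cons (.ofList (s.tl.hd.toList.filter fun c =>
      c.toNat < (median s.tl.hd.toList).toNat)) (.cons a (.nat 0)))
  else
    .cons s.hd (.cons (.ofList (s.tl.hd.toList.filter fun c =>
      (median s.tl.hd.toList).toNat < c.toNat)) s.tl.tl)

/-! ### These functions take polynomial time. -/

theorem polyTimeList_channels : PolyTimeList channels := by
  have id := PolyTime.id
  exact .insertAll (.flatMap (F := fun _ s => s.tl.toList) (.toList id.tl) (.toList id.tl.tl))

theorem polyTimeList_vertexList : PolyTimeList fun y => vertexList y.hd y.tl := by
  have id := PolyTime.id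
  refine .flatMap (.toList id.hd.tl) (F := fun y s =>
    (s.tl.toList.filter fun c => ¬ y.tl.toNat < c.toNat).map fun c => .cons s.hd c) ?_
  refine .map (G := fun y c => .cons y.tl.hd c) ?_ (id.hd.tl.hd.pair id.tl)
  exact .filter (c := fun y c => ¬ y.hd.tl.toNat < c.toNat) (.toList id.tl.tl)
    (PolyTime.decides_lt id.hd.hd.tl id.tl).not

theorem polyTimeList_edgeList : PolyTimeList fun y => edgeList y.hd y.tl := by
  have id := PolyTime.id
  refine .flatMap polyTimeList_vertexList (F := fun y u =>
    ((vertexList y.hd y.tl).filter fun v =>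
      u.hd = v.hd ∧ u ≠ v ∨ .cons u v ∈ y.hd.hd.toList).map fun v => .cons u v) ?_
  refine .map (G := fun y c => .cons y.tl c) ?_ (id.hd.tl.pair id.tl)
  refine .filter (c := fun y v => y.tl.hd = v.hd ∧ y.tl ≠ v ∨
    .cons y.tl v ∈ y.hd.hd.hd.toList) (polyTimeList_vertexList.comp id.hd) ?_
  exact ((PolyTime.decides_eq id.hd.tl.hd id.tl.hd).and
    (PolyTime.decides_eq id.hd.tl id.tl).not).or
    (PolyTimeList.decides_mem (id.hd.tl.pair id.tl) (.toList id.hd.hd.hd.hd))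

theorem polyTime_question : PolyTime fun y => question y.hd y.tl :=
  PolyTime.pair polyTimeList_vertexList polyTimeList_edgeList

theorem polyTime_median {l : Data → List Data} (hl : PolyTimeList l) :
    PolyTime fun x => median (l x) := by
  have id := PolyTime.id
  refine PolyTime.hd (PolyTimeList.filter hl (c := fun x m =>
    ¬ (l x).length < ((l x).filter fun c => c.toNat < m.toNat).length +
      ((l x).filter fun c => c.toNat < m.toNat).length ∧
    (l x).length < ((l x).filter fun c => c.toNat < m.toNat).length +
      ((l x).filter fun c => c.toNat < m.toNat).length + 2) ?_)
  have hn : PolyTime fun y => .nat (l y.hd).length := (hl.comp id.hd).length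
  have hr : PolyTime fun y => .nat ((l y.hd).filter fun c => c.toNat < y.tl.toNat).length := by
    refine PolyTimeList.length ?_
    convert PolyTimeList.filter (c := fun y c => c.toNat < y.tl.toNat) (hl.comp id.hd)
      (PolyTime.decides_lt id.tl id.hd.tl)
  exact (PolyTime.decides_lt hn (hr.add hr)).not.and
    (PolyTime.decides_lt hn ((hr.add hr).add (.const 2)))

theorem polyTime_searchInit : PolyTime searchInit := by
  have id := PolyTime.id
  exact id.pair (PolyTime.pair polyTimeList_channels
    (.ite (PolyTime.decides_eq id.tl (.const 0)) (.pair (.const 0) (.const 0)) (.const 0)))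

theorem polyTime_searchQuestion : PolyTime searchQuestion := by
  have id := PolyTime.id
  exact polyTime_question.comp (id.hd.pair (polyTime_median (.toList id.tl.hd)))

theorem polyTime_searchStep : PolyTime fun y => searchStep y.hd y.tl := by
  have id := PolyTime.id
  have hL : PolyTimeList fun y => y.hd.tl.hd.toList := .toList id.hd.tl.hd
  have hm : PolyTime fun y => median y.hd.hd.tl.hd.toList := (polyTime_median hL).comp id.hd
  have hc : PolyTime.Decides fun y => y.tl.toList.length = y.hd.hd.tl.toList.length := by
    simpa using PolyTime.decides_eq (PolyTimeList.length (.toList id.tl))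
      (PolyTimeList.length (.toList id.hd.hd.tl))
  refine .ite hc (id.hd.hd.pair (PolyTime.pair ?_ (id.tl.pair (.const 0))))
    (id.hd.hd.pair (PolyTime.pair ?_ id.hd.tl.tl))
  · exact PolyTimeList.filter (c := fun y c => c.toNat < (median y.hd.tl.hd.toList).toNat) hL
      (PolyTime.decides_lt id.tl hm)
  · exact PolyTimeList.filter (c := fun y c => (median y.hd.tl.hd.toList).toNat < c.toNat) hL
      (PolyTime.decides_lt hm id.tl)

/-! ### Feasible assignments and independent sets. -/

namespace Constraints

variable {B : Constraints}

theorem mem_vertices {p : ℕ × ℕ} : p ∈ B.vertices ↔ p.1 ∈ B.S ∧ p.2 ∈ B.D p.1 := by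
  simp only [vertices, C, Finset.mem_filter, Finset.mem_product, Finset.mem_biUnion]
  grind

/-- The vertex of the constraint graph given by the value of an assignment at a station. -/
def vertexOf (f : B.S → ℕ) (hf : ∀ s : B.S, f s ∈ B.D s) (s : B.S) : B.vertices :=
  ⟨((s : ℕ), f s), mem_vertices.2 ⟨s.2, hf s⟩⟩

theorem vertexOf_injective (f : B.S → ℕ) (hf : ∀ s : B.S, f s ∈ B.D s) :
    Function.Injective (vertexOf f hf) := by
  intro s t h
  simp only [vertexOf, Subtype.mk.injEq, Prod.mk.injEq] at h
  exact Subtype.ext h.1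

theorem exists_isNIndepSet_of_mem_feasibleSet {f : B.S → ℕ} (hf : f ∈ B.feasibleSet) :
    ∃ U, B.graph.IsNIndepSet B.S.card U := by
  refine ⟨Finset.univ.map ⟨_, vertexOf_injective f hf.1⟩, ⟨?_, by simp⟩⟩
  intro u hu v hv _ h
  simp only [Finset.coe_map, Finset.coe_univ, Set.image_univ, Function.Embedding.coeFn_mk,
    Set.mem_range] at hu hv
  obtain ⟨s, rfl⟩ := hu
  obtain ⟨t, rfl⟩ := hv
  obtain ⟨hne, h | h | h⟩ := h
  · exact hne (congrArg _ (Subtype.ext h))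
  · exact hf.2 _ _ _ _ h rfl rfl
  · exact hf.2 _ _ _ _ h rfl rfl

/-- The station of a vertex of the constraint graph. -/
def station (v : B.vertices) : B.S := ⟨v.1.1, (mem_vertices.1 v.2).1⟩

/-- Vertices of the same station are adjacent; this yields the upper bound |S| for independent sets.
-/
theorem station_injOn {U : Finset B.vertices} (hU : B.graph.IsIndepSet U) :
    Set.InjOn station (U : Set B.vertices) := by
  intro u hu v hv h
  by_contra hne
  exact hU hu hv hne ⟨hne, .inl (congrArg Subtype.val h)⟩

theorem card_le_of_isIndepSet {U : Finset B.vertices} (hU : B.graph.IsIndepSet U) :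
    U.card ≤ B.S.card := by
  simpa using Finset.card_le_card_of_injOn (t := Finset.univ) station (by simp) (station_injOn hU)

/-- A list of the vertices of an independent set with as many members as there are stations is a
list of the values of a feasible assignment. -/
theorem exists_mem_feasibleSet_of_isIndepSet {us : List B.vertices} (hn : us.Nodup)
    (hU : B.graph.IsIndepSet {v | v ∈ us}) (hc : us.length = B.S.card)
    (hI : ∀ i ∈ B.I, i.1.1 ≠ i.2.1) :
    ∃ f ∈ B.feasibleSet,
      B.IsAssignmentCode f (.ofList (us.map fun v => pairCode v.1)) := by
  have hinj : ∀ u ∈ us, ∀ v ∈ us, station u = station v → u = v := fun u hu v hv h =>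
    station_injOn (U := us.toFinset) (by convert hU; simp) (by simpa) (by simpa) h
  have hs : (us.map station).Nodup := hn.map_on hinj
  have hmem (s : B.S) : s ∈ us.map station := by
    -- Distinct stations, as many as there are in S, exhaust S.
    have : (us.map station).toFinset = Finset.univ := by
      rw [← Finset.card_eq_iff_eq_univ, List.toFinset_card_of_nodup hs]
      simp [hc]
    exact List.mem_toFinset.1 (this ▸ Finset.mem_univ s)
  have hex (s : B.S) : ∃ v ∈ us, station v = s := by simpa using hmem s
  choose g hg hgs using hex
  have hgv (v : B.vertices) (hv : v ∈ us) : g (station v) = v := hinj _ (hg _) _ hv (hgs _)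
  have hval (s : B.S) : (g s).1 = ((s : ℕ), (g s).1.2) :=
    Prod.ext (congrArg Subtype.val (hgs s)) rfl
  refine ⟨fun s => (g s).1.2, ⟨fun s => ?_, ?_⟩, us.map station, hs, hmem, ?_⟩
  · have := (mem_vertices.1 (g s).2).2
    rwa [show (g s).1.1 = s from congrArg Subtype.val (hgs s)] at this
  · rintro s t c d hi rfl rfl
    rw [← hval, ← hval] at hi
    have hne : g s ≠ g t := fun h => hI _ hi (by rw [h])
    exact hU (hg s) (hg t) hne ⟨hne, .inr (.inl hi)⟩
  · congr 1
    rw [List.map_map]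
    refine List.map_congr_left fun v hv => ?_
    simp only [Function.comp_apply, hgv v hv]
    rfl

theorem card_le_indepNum_iff : B.S.card ≤ B.graph.indepNum ↔ B.graph.indepNum = B.S.card := by
  obtain ⟨U, hU⟩ := B.graph.exists_isNIndepSet_indepNum
  have := card_le_of_isIndepSet hU.isIndepSet
  rw [hU.card_eq] at this
  omega

theorem feasibleSet_nonempty_iff (hI : ∀ i ∈ B.I, i.1.1 ≠ i.2.1) :
    B.feasibleSet.Nonempty ↔ B.graph.indepNum = B.S.card := by
  constructor
  · rintro ⟨f, hf⟩
    obtain ⟨U, hU⟩ := exists_isNIndepSet_of_mem_feasibleSet hf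
    rw [← card_le_indepNum_iff, ← hU.card_eq]
    exact hU.isIndepSet.card_le_indepNum
  · intro h
    obtain ⟨U, hU⟩ := B.graph.exists_isNIndepSet_indepNum
    obtain ⟨f, hf, -⟩ := exists_mem_feasibleSet_of_isIndepSet (us := U.toList) U.nodup_toList
      (by simpa using hU.isIndepSet) (by simp [hU.card_eq, h]) hI
    exact ⟨f, hf⟩

end Constraints

/-! ### Medians. -/

/-- The element wanted is the `k`-th smallest, counted from 0, as given by `Nat.nth`. -/
theorem exists_length_filter_lt {ns : List ℕ} (hn : ns.Nodup) {k : ℕ} (hk : k < ns.length) :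
    ∃ m ∈ ns, (ns.filter fun c => c < m).length = k := by
  have hf : {c | c ∈ ns}.Finite := ns.finite_toSet
  have hc : hf.toFinset.card = ns.length := by
    rw [← List.toFinset_card_of_nodup hn]
    congr 1
    ext
    rw [Set.Finite.mem_toFinset, List.mem_toFinset, Set.mem_ofPred_eq]
  have hk' : ∀ h : {c | c ∈ ns}.Finite, k < h.toFinset.card := fun _ => hc ▸ hk
  refine ⟨Nat.nth (· ∈ ns) k, Nat.nth_mem k hk', ?_⟩
  refine Eq.trans ?_ (Nat.count_nth hk')
  rw [Nat.count_eq_card_filter_range, ← List.toFinset_card_of_nodup (hn.filter _)]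
  congr 1
  ext c
  simp only [List.mem_toFinset, List.mem_filter, Finset.mem_filter, Finset.mem_range,
    decide_eq_true_eq]
  tauto

theorem length_filter_lt_add_length_filter_gt (ns : List ℕ) (m : ℕ) :
    (ns.filter fun c => c < m).length + (ns.filter fun c => m < c).length + ns.count m =
      ns.length := by
  induction ns with
  | nil => rfl
  | cons a ns ih =>
    simp only [List.filter_cons, List.count_cons, decide_eq_true_eq, beq_iff_eq, List.length_cons]
    rcases lt_trichotomy a m with h | h | h
    · simp [h, h.not_gt, h.ne]; omega
    · simp [h]; omega
    · simp [h, h.not_gt, h.ne']; omega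

theorem filter_map_nat (q : ℕ → Bool) (p : Data → Bool) (h : ∀ n, p (.nat n) = q n) (ns : List ℕ) :
    (ns.map nat).filter p = (ns.filter q).map nat := by
  rw [List.filter_map]
  congr 2
  funext n
  exact h n

theorem exists_median_eq {ns : List ℕ} (hn : ns.Nodup) (h0 : ns ≠ []) :
    ∃ m ∈ ns, median (ns.map nat) = .nat m ∧
      2 * (ns.filter fun c => c < m).length ≤ ns.length ∧
      2 * (ns.filter fun c => m < c).length ≤ ns.length := by
  set r : ℕ → ℕ := fun m => (ns.filter fun c => c < m).length with hr
  have hmed : median (ns.map nat) = (ofList ((ns.filter fun m =>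
      ¬ ns.length < r m + r m ∧ ns.length < r m + r m + 2).map nat)).hd := by
    unfold median
    rw [filter_map_nat (fun m => ¬ ns.length < r m + r m ∧ ns.length < r m + r m + 2)]
    intro m
    rw [filter_map_nat (fun c => c < m) _ (fun c => rfl)]
    simp [hr]
  have hlt : ns.length / 2 < ns.length :=
    Nat.div_lt_self (List.length_pos_iff.2 h0) one_lt_two
  obtain ⟨m₀, hm₀, hr₀⟩ := exists_length_filter_lt hn hlt
  -- The condition says that the rank `r m` is half the length, rounded down, without using
  -- division. An element of this rank exists, so the head taken by `median` is not the default `0`.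
  have hmem : m₀ ∈ ns.filter fun m => ¬ ns.length < r m + r m ∧ ns.length < r m + r m + 2 := by
    simp only [List.mem_filter, decide_eq_true_eq]
    refine ⟨hm₀, ?_⟩
    have : r m₀ = ns.length / 2 := hr₀
    omega
  obtain ⟨m, l, hl⟩ := List.exists_cons_of_ne_nil (List.ne_nil_of_mem hmem)
  have hm : m ∈ ns.filter fun m => ¬ ns.length < r m + r m ∧ ns.length < r m + r m + 2 := by
    rw [hl]
    exact List.mem_cons_self
  simp only [List.mem_filter, decide_eq_true_eq] at hm
  have hsplit : r m + (ns.filter fun c => m < c).length + 1 = ns.length := by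
    rw [← length_filter_lt_add_length_filter_gt ns m, List.count_eq_one_of_mem hn hm.1]
  refine ⟨m, hm.1, by rw [hmed, hl]; rfl, ?_, ?_⟩
  · change 2 * r m ≤ _
    omega
  · omega

/-! ### The oracle question codes the constraint graph. -/

theorem pairCode_injective : Function.Injective pairCode := by
  rintro ⟨a, b⟩ ⟨c, d⟩ h
  simpa [pairCode] using h

/-- The oracle question for the clearing target `m` is a code of the constraint graph. -/
theorem isGraphCode_question {B : Constraints} (hB : ∀ i ∈ B.I, i.1.1 ≠ i.2.1) {x : Data}
    (hx : B.IsCode x) (m : ℕ) :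
    IsGraphCode (fun v : (B.clear m).vertices => pairCode v.1) (B.clear m).graph
      (question x (.nat m)) := by
  obtain ⟨is, ss, dom, his, hss, hS, hdom, rfl⟩ := hx
  obtain ⟨ps, hps⟩ : ∃ ps : List (ℕ × ℕ),
    ps = ss.flatMap fun s => ((dom s).filter fun c => ¬ m < c).map fun c => (s, c) := ⟨_, rfl⟩
  have hmem (p : ℕ × ℕ) : p ∈ ps ↔ p ∈ (B.clear m).vertices := by
    rw [Constraints.mem_vertices, hps]
    obtain ⟨s, c⟩ := p
    simp only [List.mem_flatMap, List.mem_map, List.mem_filter, Constraints.clear,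
      Finset.mem_filter, Prod.mk.injEq, decide_eq_true_eq, not_lt, ← hS]
    constructor
    · rintro ⟨s, hs, c, ⟨hc, hm⟩, rfl, rfl⟩
      exact ⟨hs, ((hdom s hs).2 c).1 hc, hm⟩
    · rintro ⟨hs, hc, hm⟩
      exact ⟨s, hs, c, ⟨((hdom s hs).2 c).2 hc, hm⟩, rfl, rfl⟩
  have hnodup : ps.Nodup := by
    rw [hps, List.nodup_flatMap]
    refine ⟨fun s hs => (((hdom s hs).1.filter _).map fun a b h => by simpa using h), ?_⟩
    refine hss.pairwise_of_forall_ne fun s _ t _ hst => ?_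
    simp only [Function.onFun, List.disjoint_left, List.mem_map]
    rintro _ ⟨c, -, rfl⟩ ⟨d, -, h⟩
    exact hst (Prod.ext_iff.1 h).1.symm
  have hverts : vertexList (.cons (.ofList (is.map fun i => .cons (pairCode i.1) (pairCode i.2)))
      (.ofList (ss.map fun s => .cons (.nat s) (.ofList ((dom s).map .nat))))) (.nat m) =
      ps.map pairCode := by
    simp only [vertexList, tl_cons, toList_ofList, List.flatMap_map, hd_cons, hps,
      List.map_flatMap, List.map_map]
    congr 1
    funext s
    rw [filter_map_nat (fun c => ¬ m < c) _ fun _ => rfl]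
    simp [pairCode, Function.comp_def]
  -- From here on the listed pairs are vertices of the graph, as a graph code requires.
  lift ps to List (B.clear m).vertices using fun p hp => (hmem p).1 hp with vs hvs
  rw [List.map_map] at hverts
  refine ⟨vs, vs.flatMap fun u => (vs.filter fun v => u.1.1 = v.1.1 ∧ u ≠ v ∨ (u.1, v.1) ∈ B.I).map
    fun v => (u, v), hnodup.of_map _, fun v => ?_, fun u v => ?_, ?_⟩
  · simpa using (hmem v).2 v.2
  · have hall (v : (B.clear m).vertices) : v ∈ vs := by simpa using (hmem v).2 v.2
    have hes (u v : (B.clear m).vertices) : (u, v) ∈ (vs.flatMap fun u => (vs.filter fun v =>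
        u.1.1 = v.1.1 ∧ u ≠ v ∨ (u.1, v.1) ∈ B.I).map fun v => (u, v)) ↔
        u.1.1 = v.1.1 ∧ u ≠ v ∨ (u.1, v.1) ∈ B.I := by
      simp [hall]
    rw [hes, hes]
    change u ≠ v ∧ (u.1.1 = v.1.1 ∨ (u.1, v.1) ∈ B.I ∨ (v.1, u.1) ∈ B.I) ↔ _
    -- An interference constraint joins different stations, so `edgeList` lists no loops although it
    -- tests `u ≠ v` only within a station.
    have h1 (h : (u.1, v.1) ∈ B.I) : u ≠ v := fun e => hB _ h (by rw [e])
    have h2 (h : (v.1, u.1) ∈ B.I) : u ≠ v := fun e => hB _ h (by rw [e])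
    constructor
    · rintro ⟨hne, h | h | h⟩
      · exact .inl (.inl ⟨h, hne⟩)
      · exact .inl (.inr h)
      · exact .inr (.inr h)
    · rintro ((h | h) | (h | h))
      · exact ⟨h.2, .inl h.1⟩
      · exact ⟨h1 h, .inr (.inl h)⟩
      · exact ⟨h.2.symm, .inl h.1.symm⟩
      · exact ⟨h2 h, .inr (.inr h)⟩
  · rw [question, edgeList, hverts]
    congr 2
    simp only [List.flatMap_map, List.map_flatMap, List.filter_map, List.map_map]
    congr 1
    funext u
    refine congrArg _ (congrArg (fun p => List.filter p vs) ?_)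
    funext v
    simp only [Function.comp_apply, hd_cons, toList_ofList, pairCode_injective.ne_iff,
      Subtype.coe_ne_coe, List.mem_map, Data.cons.injEq, pairCode_injective.eq_iff, ← his]
    congr 1
    apply propext
    simp [pairCode]

/-! ### Clearing targets and input codes. -/

namespace Constraints

variable {B : Constraints}

/-- A maximum is at most `m` exactly when all values are. Feasibility is therefore monotone in the
target, as binary search needs. -/
theorem mem_feasibleSet_clear {m : ℕ} {f : B.S → ℕ} :
    f ∈ (B.clear m).feasibleSet ↔ f ∈ B.feasibleSet ∧ B.cost f ≤ m := by
  have hc : B.cost f ≤ m ↔ ∀ s, f s ≤ m := by simp [cost]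
  rw [hc]
  constructor
  · rintro ⟨h₁, h₂⟩
    exact ⟨⟨fun s => (Finset.mem_filter.1 (h₁ s)).1, h₂⟩, fun s => (Finset.mem_filter.1 (h₁ s)).2⟩
  · rintro ⟨⟨h₁, h₂⟩, h₃⟩
    exact ⟨fun s => Finset.mem_filter.2 ⟨h₁ s, h₃ s⟩, h₂⟩

/-- The maximum is attained, so only channels need be searched. Without stations the cost is 0 but C
is empty. -/
theorem cost_mem_C (hS : B.S.Nonempty) {f : B.S → ℕ} (hf : f ∈ B.feasibleSet) :
    B.cost f ∈ B.C := by
  have : Nonempty B.S := hS.to_subtype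
  obtain ⟨s, -, hs⟩ := Finset.exists_mem_eq_sup Finset.univ Finset.univ_nonempty f
  rw [cost, hs]
  exact Finset.mem_biUnion.2 ⟨s, s.2, hf.1 s⟩

theorem IsCode.length_tl {x : Data} (hx : B.IsCode x) : x.tl.toList.length = B.S.card := by
  obtain ⟨is, ss, dom, -, hss, hS, -, rfl⟩ := hx
  rw [tl_cons, toList_ofList, List.length_map, ← List.toFinset_card_of_nodup hss]
  congr 1
  ext s
  simp [hS]

theorem IsCode.exists_channels {x : Data} (hx : B.IsCode x) :
    ∃ ns : List ℕ, ns.Nodup ∧ (∀ c, c ∈ ns ↔ c ∈ B.C) ∧ channels x = ns.map nat := by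
  obtain ⟨is, ss, dom, -, -, hS, hdom, rfl⟩ := hx
  set L := (ss.flatMap dom).map nat with hL
  have hch : channels (.cons (.ofList (is.map fun i => .cons (pairCode i.1) (pairCode i.2)))
      (.ofList (ss.map fun s => .cons (.nat s) (.ofList ((dom s).map .nat))))) =
      insertAll L [] := by
    simp [channels, List.flatMap_map, hL, List.map_flatMap]
  rw [hch]
  have hmem (d : Data) : d ∈ insertAll L [] ↔ ∃ c ∈ B.C, nat c = d := by
    simp only [mem_insertAll, hL, List.mem_map, List.mem_flatMap, C, Finset.mem_biUnion, hS,
      List.not_mem_nil, or_false]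
    constructor
    · rintro ⟨c, ⟨s, hs, hc⟩, rfl⟩
      exact ⟨c, ⟨s, hs, ((hdom s ((hS s).2 hs)).2 c).1 hc⟩, rfl⟩
    · rintro ⟨c, ⟨s, hs, hc⟩, rfl⟩
      exact ⟨c, ⟨s, hs, ((hdom s ((hS s).2 hs)).2 c).2 hc⟩, rfl⟩
  have hmap : insertAll L [] = ((insertAll L []).map toNat).map nat := by
    rw [List.map_map]
    refine ((List.map_congr_left fun d hd => ?_).trans (List.map_id _)).symm
    obtain ⟨c, -, rfl⟩ := (hmem d).1 hd
    rfl
  refine ⟨(insertAll L []).map toNat, ?_, fun c => ?_, hmap⟩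
  · have := nodup_insertAll (L := L) List.nodup_nil
    rw [hmap] at this
    exact this.of_map _
  · rw [← List.mem_map_of_injective (f := nat) (fun a b h => by simpa using h), ← hmap, hmem]
    simp

end Constraints

/-- Bounds both the oracle's answer, a rearranged part of the vertex list in the question, and the
shrinking list of candidates. -/
theorem size_ofList_map_le_of_subperm {α : Type*} {l₁ l₂ : List α} (h : l₁.Subperm l₂)
    (f : α → Data) : (ofList (l₁.map f)).size ≤ (ofList (l₂.map f)).size := by
  obtain ⟨l, hl, hs⟩ := h
  rw [size_ofList, size_ofList, ← ((hl.map f).map _).sum_eq]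
  exact Nat.add_le_add_right (((hs.map f).map _).sum_le_sum fun _ _ => Nat.zero_le _) 1

variable {O : Data → Data} {B : Constraints} {x : Data}

/-- What one call provides: a bound for the cost of reading the answer, and an assignment of cost at
most `m` or a proof that none exists. If the length is not |S|, neither is the independence number.
-/
theorem SolvesMISP.answer (hO : SolvesMISP O) (hB : ∀ i ∈ B.I, i.1.1 ≠ i.2.1)
    (hx : B.IsCode x) (m : ℕ) :
    (O (question x (.nat m))).size ≤ (question x (.nat m)).size ∧
      ((O (question x (.nat m))).toList.length = x.tl.toList.length →
        ∃ f ∈ B.feasibleSet, B.cost f ≤ m ∧ B.IsAssignmentCode f (O (question x (.nat m)))) ∧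
      ((O (question x (.nat m))).toList.length ≠ x.tl.toList.length →
        ∀ g ∈ B.feasibleSet, m < B.cost g) := by
  have hq := isGraphCode_question hB hx m
  obtain ⟨U, us, hU, hus, hmem, ha⟩ := hO (B.clear m).vertices (fun v => pairCode v.1)
    (B.clear m).graph _ (fun u v h => Subtype.ext (pairCode_injective h)) hq
  have hset : {v | v ∈ us} = (U : Set (B.clear m).vertices) := by
    ext v
    simp [hmem]
  have hlen : us.length = U.card := by
    rw [← List.toFinset_card_of_nodup hus]
    congr 1
    ext v
    simp [hmem]
  have hcard : U.card = (B.clear m).graph.indepNum :=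
    SimpleGraph.maximumIndepSet_card_eq_indepNum U hU
  rw [ha, hx.length_tl, toList_ofList, List.length_map]
  refine ⟨?_, fun h => ?_, fun h g hg => ?_⟩
  · obtain ⟨vs, es, hvs, hall, -, hq⟩ := hq
    rw [hq]
    have := size_ofList_map_le_of_subperm (hus.subperm fun v _ => hall v)
      fun v : (B.clear m).vertices => pairCode v.1
    simp only [size]
    omega
  · obtain ⟨f, hf, hc⟩ := Constraints.exists_mem_feasibleSet_of_isIndepSet (B := B.clear m) hus
      (hset ▸ hU.isIndepSet) h hB
    obtain ⟨hf, hm⟩ := Constraints.mem_feasibleSet_clear.1 hf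
    exact ⟨f, hf, hm, hc⟩
  · by_contra! hm
    refine h ?_
    rw [hlen, hcard]
    exact (Constraints.feasibleSet_nonempty_iff (B := B.clear m) hB).1
      ⟨g, Constraints.mem_feasibleSet_clear.2 ⟨hg, hm⟩⟩

/-! ### The binary search. -/

/-- The invariant of the binary search with candidates `ns` and best answer `y`: either there is no
answer yet and every feasible cost is a candidate, or `y` is an answer of cost at most `b`, and the
feasible costs below `b` are candidates. -/
def SearchInv (B : Constraints) (ns : List ℕ) (y : Data) : Prop :=
  (y = .ofList [] ∧ ∀ g ∈ B.feasibleSet, B.cost g ∈ ns) ∨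
    ∃ b, ∃ f ∈ B.feasibleSet, ∃ z, B.IsAssignmentCode f z ∧ y = .ofList [z] ∧ B.cost f ≤ b ∧
      (∀ c ∈ ns, c ≤ b) ∧ ∀ g ∈ B.feasibleSet, B.cost g ∈ ns ∨ b ≤ B.cost g

namespace SearchInv

variable {ns : List ℕ} {y z : Data} {m : ℕ}

/-- With no candidates left, either no cost is feasible, or every feasible cost is at least `b`,
hence at least that of the stored assignment. -/
theorem isAnswer (h : SearchInv B [] y) : B.IsAnswer y := by
  obtain ⟨rfl, h⟩ | ⟨b, f, hf, z, hz, rfl, hb, -, h⟩ := h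
  · exact .inr ⟨Set.eq_empty_of_forall_notMem fun g hg => by simpa using h g hg, rfl⟩
  · refine .inl ⟨f, ⟨hf, fun g hg => ?_⟩, z, hz, rfl⟩
    exact hb.trans ((h g hg).resolve_left List.not_mem_nil)

/-- The target `m` becomes the new `b`, though the assignment may cost less. Since `m` is at most
the old `b`, all feasible costs below `m` were candidates. -/
theorem accept (h : SearchInv B ns y) (hm : m ∈ ns) {f : B.S → ℕ} (hf : f ∈ B.feasibleSet)
    (hfm : B.cost f ≤ m) (hz : B.IsAssignmentCode f z) :
    SearchInv B (ns.filter fun c => c < m) (.ofList [z]) := by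
  refine .inr ⟨m, f, hf, z, hz, rfl, hfm, fun c hc => ?_, fun g hg => ?_⟩
  · simp at hc
    omega
  · have hg' : B.cost g ∈ ns ∨ m ≤ B.cost g := by
      obtain ⟨-, h⟩ | ⟨b, -, -, -, -, -, -, hb, h⟩ := h
      · exact .inl (h g hg)
      · exact (h g hg).imp_right (hb m hm).trans
    simp only [List.mem_filter, decide_eq_true_eq]
    rcases lt_or_ge (B.cost g) m with h | h
    · exact .inl ⟨hg'.resolve_right h.not_ge, h⟩
    · exact .inr h

theorem reject (h : SearchInv B ns y) (hm : ∀ g ∈ B.feasibleSet, m < B.cost g) :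
    SearchInv B (ns.filter fun c => m < c) y := by
  obtain ⟨hy, h⟩ | ⟨b, f, hf, z, hz, hy, hb, hns, h⟩ := h
  · exact .inl ⟨hy, fun g hg => by simp [h g hg, hm g hg]⟩
  · exact .inr ⟨b, f, hf, z, hz, hy, hb, fun c hc => hns c (List.mem_of_mem_filter hc),
      fun g hg => by simpa [hm g hg] using h g hg⟩

theorem init (hx : B.IsCode x) (hns : ∀ c, c ∈ ns ↔ c ∈ B.C) :
    SearchInv B ns (if x.tl = .nat 0 then .cons (.nat 0) (.nat 0) else .nat 0) := by
  have hS : x.tl = .nat 0 ↔ B.S = ∅ := by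
    obtain ⟨is, ss, dom, -, -, hS, -, rfl⟩ := hx
    rw [tl_cons, show nat 0 = ofList [] from rfl, ofList_injective.eq_iff, List.map_eq_nil_iff,
      List.eq_nil_iff_forall_not_mem, Finset.eq_empty_iff_forall_notMem]
    simp only [hS]
  split_ifs with h
  · rw [hS] at h
    have he : IsEmpty B.S := by rw [h]; infer_instance
    -- Without stations there is no channel to ask about; the initial answer is the one-element list
    -- holding the empty assignment, already optimal.
    refine .inr ⟨0, fun _ => 0, ⟨fun s => he.elim s, fun s => he.elim s⟩, .ofList [],
      ⟨[], by simp, fun s => he.elim s, rfl⟩, rfl, by simp [Constraints.cost], fun c hc => ?_,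
      fun _ _ => .inr (Nat.zero_le _)⟩
    rw [hns, Constraints.C, h] at hc
    simp at hc
  · exact .inl ⟨rfl, fun g hg => (hns _).2 (Constraints.cost_mem_C
      (Finset.nonempty_iff_ne_empty.2 (hS.not.1 h)) hg)⟩

end SearchInv

/-- A state of the binary search. -/
def searchState (x : Data) (ns : List ℕ) (y : Data) : Data :=
  .cons x (.cons (.ofList (ns.map nat)) y)

/-- The stored answer is either kept or bounded by the current question alone, so its size does not
accumulate over the rounds. -/
theorem exists_searchStep_eq (hO : SolvesMISP O) (hB : ∀ i ∈ B.I, i.1.1 ≠ i.2.1)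
    (hx : B.IsCode x) {ns : List ℕ} {y : Data} (hn : ns.Nodup) (h0 : ns ≠ [])
    (hy : SearchInv B ns y) :
    ∃ m ∈ ns, searchQuestion (searchState x ns y) = question x (.nat m) ∧
      (O (question x (.nat m))).size ≤ (question x (.nat m)).size ∧
      ∃ ns' y', ns'.Sublist ns ∧ 2 * ns'.length ≤ ns.length ∧ SearchInv B ns' y' ∧
        (y' = y ∨ y'.size ≤ (question x (.nat m)).size + 2) ∧
        searchStep (searchState x ns y) (O (question x (.nat m))) = searchState x ns' y' := by
  obtain ⟨m, hm, hmed, hlt, hgt⟩ := exists_median_eq hn h0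
  obtain ⟨hsize, hyes, hno⟩ := hO.answer hB hx m
  refine ⟨m, hm, by simp [searchQuestion, searchState, hmed], hsize, ?_⟩
  by_cases h : (O (question x (.nat m))).toList.length = x.tl.toList.length
  · obtain ⟨f, hf, hfm, hz⟩ := hyes h
    refine ⟨_, _, List.filter_sublist, hlt, hy.accept hm hf hfm hz, .inr ?_, ?_⟩
    · simp only [ofList, size, Nat.size_zero]
      omega
    · simp only [searchStep, searchState, hd_cons, tl_cons, toList_ofList, hmed, if_pos h]
      rw [filter_map_nat (fun c => c < m) _ fun _ => rfl]
      rfl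
  · refine ⟨_, _, List.filter_sublist, hgt, hy.reject (hno h), .inl rfl, ?_⟩
    simp only [searchStep, searchState, hd_cons, tl_cons, toList_ofList, hmed, if_neg h]
    rw [filter_map_nat (fun c => m < c) _ fun _ => rfl]

/-- The binary search, given programs for the preparation of a question and for the evaluation of
the answer. -/
def searchLoop (P Q : Prog) : Prog :=
  .loop Expr.pending.isCons <| .seq P <| .seq (.query 2 (.tl (.var 0))) <|
    .seq (.assign 0 (.cons (.hd (.var 0)) (.var 2))) Q

/-- A bound for the time of one round of the binary search, in terms of bounds for the sizes of the
states and questions. -/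
noncomputable def searchTime (p q : ℕ[X]) : ℕ[X] :=
  p.comp (X + 1) + q.comp (2 * X + 2) + 40 * X + 40

/-- Induction on `k`: each round halves the candidates, so `k` rounds exhaust fewer than `2 ^ k` of
them. `Z` bounds a state: input, candidates, an answer of size at most `M + 2`, and two pairing
symbols. -/
theorem exec_searchLoop {P Q : Prog} {p q : ℕ[X]}
    (hP : P.Computes (fun s => .cons s (searchQuestion s)) p)
    (hQ : Q.Computes (fun y => searchStep y.hd y.tl) q)
    (hO : SolvesMISP O) (hB : ∀ i ∈ B.I, i.1.1 ≠ i.2.1) (hx : B.IsCode x) {M Z : ℕ}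
    (hM : ∀ m ∈ B.C, (question x (.nat m)).size ≤ M) (k : ℕ) :
    ∀ (ns : List ℕ) (y : Data) (σ : Store), ns.length < 2 ^ k → ns.Nodup → (∀ c ∈ ns, c ∈ B.C) →
      y.size ≤ M + 2 → x.size + (ofList (ns.map nat)).size + M + 4 ≤ Z → SearchInv B ns y →
      σ 0 = searchState x ns y → σ 1 = .nat 0 →
      ∃ (σ' : Store) (t : ℕ) (qs : List Data), Exec O (searchLoop P Q) σ σ' t qs ∧
        B.IsAnswer (σ' 0).tl.tl ∧ (σ' 0).size ≤ Z ∧ t ≤ (k + 1) * (searchTime p q).eval Z ∧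
        qs.length ≤ k ∧ ∀ d ∈ qs, ∃ c ∈ B.C, d = question x (.nat c) := by
  have hT : (searchTime p q).eval Z = p.eval (Z + 1) + q.eval (2 * Z + 2) + 40 * Z + 40 := by
    simp [searchTime]
  induction k with
  | zero =>
    intro ns y σ hk _ _ hy hZ hinv h₀ _
    obtain rfl : ns = [] := by simpa using hk
    have hs : (σ 0).size ≤ Z := by
      simp only [h₀, searchState, size, List.map_nil] at hZ ⊢
      omega
    refine ⟨σ, _, [], .loop_false (Expr.eval_isCons_eq (n := 0) ?_), ?_, hs, ?_, by simp, by simp⟩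
    · simp [Expr.pending, Expr.eval, h₀, searchState, ofList]
    · simpa [h₀, searchState] using hinv.isAnswer
    · have := Expr.cost_isCons_pending_le σ
      rw [hT]
      omega
  | succ k ih =>
    intro ns y σ hk hn hC hy hZ hinv h₀ hst
    have hs : (σ 0).size ≤ Z := by
      simp only [h₀, searchState, size]
      omega
    have hcost := Expr.cost_isCons_pending_le σ
    rcases eq_or_ne ns [] with rfl | h0
    · refine ⟨σ, _, [], .loop_false (Expr.eval_isCons_eq (n := 0) ?_), ?_, hs, ?_, by simp,
        by simp⟩
      · simp [Expr.pending, Expr.eval, h₀, searchState, ofList]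
      · simpa [h₀, searchState] using hinv.isAnswer
      · rw [hT, Nat.add_mul]
        omega
    · obtain ⟨m, hm, hq, ha, ns', y', hsub, hlen, hinv', hy', hstep⟩ :=
        exists_searchStep_eq hO hB hx hn h0 hinv
      have hMm := hM m (hC m hm)
      obtain ⟨σ₁, t₁, e₁, h₁, h₁', ht₁⟩ := hP O σ
      beta_reduce at h₁
      rw [h₀, hq] at h₁
      rw [hst] at h₁'
      set a := O (question x (.nat m)) with ha'
      -- `P` leaves the pair of state and question; the question is then exchanged for the answer,
      -- giving the input of `Q`.
      set σ₂ := Function.update (Function.update σ₁ 2 a) 0 (.cons (σ 0) a) with hσ₂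
      obtain ⟨σ₃, t₃, e₃, h₃, h₃', ht₃⟩ := hQ O σ₂
      have a₀ : σ₂ 0 = .cons (σ 0) a := by simp [hσ₂]
      have a₁ : σ₂ 1 = .nat 0 := by simp [hσ₂, h₁']
      simp only [a₀, hd_cons, tl_cons, h₀, hstep] at h₃
      rw [a₁] at h₃'
      have hsubsize := size_ofList_map_le_of_subperm hsub.subperm nat
      obtain ⟨σ₄, t₄, qs, e₄, h₄, hs₄, ht₄, hqs, hqs'⟩ := ih ns' y' σ₃
        (by rw [pow_succ] at hk; omega) (hn.sublist hsub) (fun c hc => hC c (hsub.subset hc))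
        (by rcases hy' with rfl | hy' <;> omega) (by omega) hinv' h₃ h₃'
      have hquery : (Expr.tl (.var 0)).eval σ₁ = question x (.nat m) := by simp [Expr.eval, h₁]
      have e₂ : Exec O (.query 2 (.tl (.var 0))) σ₁ (Function.update σ₁ 2 a)
          ((Expr.tl (.var 0)).cost σ₁ + a.size + 1) [question x (.nat m)] := by
        have := Exec.query (O := O) 2 (.tl (.var 0)) σ₁
        rwa [hquery] at this
      have e₂' : Exec O (.assign 0 (.cons (.hd (.var 0)) (.var 2))) (Function.update σ₁ 2 a) σ₂
          ((Expr.cons (.hd (.var 0)) (.var 2)).cost (Function.update σ₁ 2 a) + 1) [] := by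
        convert Exec.assign (O := O) 0 (.cons (.hd (.var 0)) (.var 2)) (Function.update σ₁ 2 a)
          using 2
        simp [Expr.eval, h₁, h₀]
      refine ⟨σ₄, _, _, .loop_true (Expr.eval_isCons_ne (a := (ofList (ns.map nat)).hd)
        (b := (ofList (ns.map nat)).tl) ?_) (.seq e₁ (.seq e₂ (.seq e₂' e₃))) e₄, h₄, hs₄, ?_,
        ?_, ?_⟩
      · obtain ⟨b, l, rfl⟩ := List.exists_cons_of_ne_nil h0
        simp [Expr.pending, Expr.eval, h₀, searchState, ofList]
      · rw [hst] at ht₁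
        rw [a₀, a₁] at ht₃
        simp only [size, Nat.size_zero] at ht₁ ht₃
        have b₁ := ht₁.trans (eval_le_eval p (b := Z + 1) (by omega))
        have b₃ := ht₃.trans (eval_le_eval q (b := 2 * Z + 2) (by omega))
        rw [Nat.add_mul (k + 1), one_mul, hT]
        rw [hT] at ht₄
        rw [← h₀] at h₁
        simp [Expr.cost, Expr.eval, h₁, size]
        omega
      · simp
        omega
      · simp only [List.nil_append, List.append_nil, List.cons_append, List.mem_cons]
        rintro d (rfl | hd)
        · exact ⟨m, hC m hm, rfl⟩
        · exact hqs' d hd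

end BRP

/-! ### Assembling the reduction. -/

theorem mainTheorem5 :
    ∃ (P : BRP.Prog) (p : Polynomial ℕ) (K : ℕ),
      ∀ O : BRP.Data → BRP.Data, BRP.SolvesMISP O →
      ∀ B : BRP.Constraints, B.Valid →
      ∀ x : BRP.Data, B.IsCode x →
      ∃ (y : BRP.Data) (t : ℕ) (qs : List BRP.Data),
        P.Runs O x y t qs ∧
        B.IsAnswer y ∧
        t ≤ p.eval x.size ∧
        qs.length ≤ K * (Nat.log 2 B.C.card + 1) ∧
        ∀ q ∈ qs, ∃ c ∈ B.C,
          BRP.IsGraphCode (fun v => BRP.pairCode v.1) (B.clear c).graph q ∧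
          ((B.clear c).feasibleSet.Nonempty ↔ (B.clear c).graph.indepNum = B.S.card) := by
  open BRP Polynomial in
  obtain ⟨P₀, p₀, q₀, hP₀, hq₀⟩ := polyTime_searchInit
  obtain ⟨P₁, p₁, -, hP₁, -⟩ := PolyTime.pair .id polyTime_searchQuestion
  obtain ⟨P₂, p₂, -, hP₂, -⟩ := polyTime_searchStep
  obtain ⟨-, -, q, -, hq⟩ := polyTime_question
  -- A question is computed from the pair of `x` and a channel, and channels occur in the initial
  -- state, bounded by `q₀`. The final `+ 1` makes `M + 2` at least 3, the size of the initial
  -- answer when there are no stations.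
  let M : ℕ[X] := q.comp (X + q₀ + 1) + 1
  let Z : ℕ[X] := X + q₀ + M + 4
  refine ⟨.seq P₀ (.seq (searchLoop P₁ P₂) (.assign 0 (.tl (.tl (.var 0))))),
    p₀.comp (X + 1) + (q₀ + 2) * (searchTime p₁ p₂).comp Z + 3 * Z + 1, 1,
    fun O hO B hB x hx => ?_⟩
  obtain ⟨ns, hn, hns, hch⟩ := hx.exists_channels
  have hcard : ns.length = B.C.card := by
    rw [← List.toFinset_card_of_nodup hn]
    congr 1
    ext c
    simp [hns]
  obtain ⟨σ₀, t₀, e₀, h₀, h₀', ht₀⟩ := hP₀ O (Function.update (fun _ => .nat 0) 0 x)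
  simp only [Function.update_self, ne_eq, one_ne_zero, not_false_eq_true,
    Function.update_of_ne, Data.size, Nat.size_zero, zero_add] at h₀ h₀' ht₀
  have hinit := hq₀ x
  set y₀ : Data := if x.tl = .nat 0 then .cons (.nat 0) (.nat 0) else .nat 0 with hy₀
  have hstate : searchInit x = searchState x ns y₀ := by
    rw [searchInit, hch, searchState]
  rw [hstate, searchState] at hinit
  simp only [Data.size] at hinit
  have hM (m : ℕ) (hm : m ∈ B.C) : (question x (.nat m)).size ≤ M.eval x.size := by
    refine (hq (.cons x (.nat m))).trans ?_
    have : Data.nat m ∈ (Data.ofList (ns.map .nat)).toList := by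
      simpa using (hns m).2 hm
    have := Data.size_le_of_mem_toList this
    simp only [M, eval_comp, eval_add, eval_X, eval_one, Data.size] at this ⊢
    exact (eval_le_eval _ (by omega)).trans (Nat.le_succ _)
  have hy₀size : y₀.size ≤ M.eval x.size + 2 := by
    have : 1 ≤ M.eval x.size := by simp [M]
    rw [hy₀]
    split <;> simp only [Data.size, Nat.size_zero] <;> omega
  -- Here `k` is log₂|C| + 1, so `K = 1` suffices.
  obtain ⟨σ₁, t₁, qs, e₁, h₁, hs₁, ht₁, hqs, hqs'⟩ := exec_searchLoop hP₁ hP₂ hO hB.station_ne hx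
    (Z := Z.eval x.size) hM (Nat.log 2 ns.length + 1) ns y₀ σ₀ (Nat.lt_pow_succ_log_self one_lt_two _)
    hn (fun c => (hns c).1) hy₀size (by simp only [Z, eval_add, eval_X, eval_ofNat]; omega)
    (.init hx hns) (h₀.trans hstate) h₀'
  refine ⟨_, _, _, ⟨_, .seq e₀ (.seq e₁ (.assign _ _ _)), Function.update_self ..⟩, h₁, ?_, ?_, ?_⟩
  · have hlog : Nat.log 2 ns.length ≤ q₀.eval x.size := by
      have h₁ := Nat.log_le_self 2 ns.length
      have h₂ := (Data.ofList (ns.map .nat)).length_toList_le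
      rw [Data.toList_ofList, List.length_map] at h₂
      omega
    have h₂ := ht₁.trans (Nat.mul_le_mul_right _ (Nat.add_le_add_right hlog 2))
    have h₃ := (σ₁ 0).size_tl_le
    have h₄ := (σ₁ 0).tl.size_tl_le
    simp only [eval_add, eval_mul, eval_comp, eval_X, eval_one, eval_ofNat, Expr.cost, Expr.eval]
    omega
  · simpa [hcard] using hqs
  · intro d hd
    obtain ⟨c, hc, rfl⟩ := hqs' d (by simpa using hd)
    exact ⟨c, hc, isGraphCode_question hB.station_ne hx c,
      Constraints.feasibleSet_nonempty_iff (B := B.clear c) hB.station_ne⟩
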